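/- Let $0<p<1$, let $n\ge 0$, and let $\mu$ be the $p$-biased measure on $\{-1,1\}^n$, i.e. the product measure in which each coordinate equals $1$ with probability $p$ and $-1$ with probability $1-p$. For $q\ge 1$ let $\|f\|_q=\left(\int |f|^q\,d\mu\right)^{1/q}$. For $S\subseteq\{1,\dots,n\}$ let $\chi_S(x)=\prod_{i\in S}\chi_i(x)$, where $\chi_i(x)=\sqrt{\frac{1-p}{p}}$ if $x_i=1$ and $\chi_i(x)=-\sqrt{\frac{p}{1-p}}$ if $x_i=-1$. For $f:\{-1,1\}^n\to\mathbb{R}$ let $\hat f(S)=\int f\chi_S\,d\mu$, and for $\gamma\in\mathbb{R}$ let $$T_\gamma f=\sum_{S\subseteq\{1,\dots,n\}}\gamma^{|S|}\hat f(S)\chi_S ,\qquad \gamma^0=1 .$$ Let $\lambda=\min\{p,1-p\}$, and let $\rho(q)$, for $q\ge 2$, be any one of the following three functions: 1. $\rho(q)=\lambda^{\frac12-\frac1q}$; 2. $\rho(q)=\sqrt{q-1}\,\sqrt{\dfrac{\sinh\left(-\frac1q\ln\frac{\lambda}{1-\lambda}\right)}{\sinh\left(-\left(1-\frac1q\right)\ln\frac{\lambda}{1-\lambda}\right)}}$,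 read as its limit $1$ when $\lambda=\frac12$; 3. $\rho(q)=\sqrt{\dfrac{\lambda}{1-\lambda}}$. Put $\rho_1(\delta)=\rho\left(\frac1{\delta^2}+1\right)$ for $0<\delta\le 1$; for $\delta=0$ the product $\rho_1(\delta)\delta$ is read as $0$. Then for every $f:\{-1,1\}^n\to\mathbb{R}$ and every $0\le\delta\le 1$, $$\left\|T_{\rho_1(\delta)\,\delta}f\right\|_2\le\|f\|_{1+\delta^2}.$$ -/

import Mathlib

/-- The cube `{-1,1}^n`; the two-point set `{-1,1}` is the unit group of `ℤ`. -/
abbrev Cube (n : ℕ) : Type := Fin n → ℤˣ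

noncomputable section

/-- The weights of the one-coordinate measure: `1` has weight `p`, `-1` has weight `1 - p`. -/
def bitWeight (p : ℝ) (b : ℤˣ) : ℝ := if b = 1 then p else 1 - p

/-- The `p`-biased (product) measure of the point `x`. -/
def biasedWeight (p : ℝ) {n : ℕ} (x : Cube n) : ℝ := ∏ i, bitWeight p (x i)

/-- The norm of `L^q` of the `p`-biased measure, `(∫ |f|^q dμ)^(1/q)`. -/
def biasedNorm (p : ℝ) {n : ℕ} (q : ℝ) (f : Cube n → ℝ) : ℝ :=
  (∑ x, |f x| ^ q * biasedWeight p x) ^ (1 / q)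

/-- The normalized coordinate `(b - E b) / σ`, explicitly. -/
def bitChar (p : ℝ) (b : ℤˣ) : ℝ :=
  if b = 1 then √((1 - p) / p) else -√(p / (1 - p))

/-- The orthonormal basis function `χ_S = ∏_{i ∈ S} χ_i`. -/
def biasedChar (p : ℝ) {n : ℕ} (S : Finset (Fin n)) (x : Cube n) : ℝ :=
  ∏ i ∈ S, bitChar p (x i)

/-- The Fourier coefficient `⟨f, χ_S⟩` with respect to the `p`-biased measure. -/
def biasedFourier (p : ℝ) {n : ℕ} (f : Cube n → ℝ) (S : Finset (Fin n)) : ℝ :=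
  ∑ x, f x * biasedChar p S x * biasedWeight p x

/-- The smoothing operator `T_γ f = ∑_S γ^|S| f̂(S) χ_S` (with `γ^0 = 1`, also for `γ = 0`). -/
def smoothing (p γ : ℝ) {n : ℕ} (f : Cube n → ℝ) : Cube n → ℝ :=
  fun x => ∑ S : Finset (Fin n), γ ^ S.card * biasedFourier p f S * biasedChar p S x

/-- `λ = min {p, 1 - p}`. -/
def minProb (p : ℝ) : ℝ := min p (1 - p)

/-- First smoothing parameter: `λ^(1/2 - 1/q)`. -/
def rhoPower (p q : ℝ) : ℝ := minProb p ^ (1 / 2 - 1 / q)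

/-- Second smoothing parameter:
`√(q-1) √(sinh(-(1/q) ln(λ/(1-λ))) / sinh(-(1-1/q) ln(λ/(1-λ))))`.
For `λ = 1/2` the quotient reads `0/0`, and the value is the limit as `λ → 1/2`, which is `1`. -/
def rhoSinh (p q : ℝ) : ℝ :=
  if p = 1 / 2 then 1
  else √(q - 1) *
    √(Real.sinh (-(1 / q) * Real.log (minProb p / (1 - minProb p))) /
      Real.sinh (-(1 - 1 / q) * Real.log (minProb p / (1 - minProb p))))

/-- Third smoothing parameter: `√(λ/(1-λ))`, independent of `q`. -/
def rhoRatio (p : ℝ) (_q : ℝ) : ℝ := √(minProb p / (1 - minProb p))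

/-- `ρ₁(δ) = ρ(1/δ² + 1)`. At `δ = 0` only the product `ρ₁(δ) * δ` is used, and it is `0` whatever
(finite) value `ρ₁(0)` has. -/
def rhoOne (ρ : ℝ → ℝ) (δ : ℝ) : ℝ := ρ (1 / δ ^ 2 + 1)

end

/-!
Tensorizing with Minkowski's inequality reduces the claim to `n = 1`. There, write the weights as
`p, 1 - p ∝ exp (∓ θ z)` and the values of a positive function as `c * exp (∓ w)`, with `θ = s / 2`.
The two-point inequality from `L^s` to `L^2` then says exactly that `cosh (θ z) ^ (1 / θ)`, as a
function of `cosh z`, lies above its tangent at `z` when evaluated at `z + 2 w`. This function is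
convex for `1 / 2 ≤ θ ≤ 1`, and the tangent slope produces the sharp constant
`sinh ((2 θ - 1) z) / sinh z`, which is `(ρ₁(δ) δ) ^ 2` for the second choice of `ρ`. The other two
choices are smaller, by Bernoulli's inequality.
-/

open Real Set Filter Topology

section Hyperbolic

theorem hasDerivAt_sinh_const_mul (a x : ℝ) :
    HasDerivAt (fun x => sinh (a * x)) (cosh (a * x) * a) x := by
  simpa using ((hasDerivAt_id x).const_mul a).sinh

theorem hasDerivAt_cosh_const_mul_rpow (θ m z : ℝ) :
    HasDerivAt (fun z => cosh (θ * z) ^ m)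
      (sinh (θ * z) * θ * m * cosh (θ * z) ^ (m - 1)) z := by
  have h : HasDerivAt (fun z => cosh (θ * z)) (sinh (θ * z) * θ) z := by
    simpa using ((hasDerivAt_id z).const_mul θ).cosh
  exact h.rpow_const (Or.inl (cosh_pos _).ne')

theorem sinh_mul_le_mul_sinh {a z : ℝ} (ha0 : 0 ≤ a) (ha1 : a ≤ 1) (hz : 0 ≤ z) :
    sinh (a * z) ≤ a * sinh z := by
  have hd (x : ℝ) : HasDerivAt (fun x => a * sinh x - sinh (a * x))
      (a * cosh x - cosh (a * x) * a) x :=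
    ((hasDerivAt_sinh x).const_mul a).sub (hasDerivAt_sinh_const_mul a x)
  have hmono : MonotoneOn (fun x => a * sinh x - sinh (a * x)) (Ici 0) := by
    refine monotoneOn_of_deriv_nonneg (convex_Ici 0)
      (fun x _ => (hd x).continuousAt.continuousWithinAt)
      (fun x _ => (hd x).differentiableAt.differentiableWithinAt) fun x hx => ?_
    rw [interior_Ici, mem_Ioi] at hx
    have hcosh : cosh (a * x) ≤ cosh x := by
      rw [cosh_le_cosh, abs_mul, abs_of_nonneg ha0]
      exact mul_le_of_le_one_left (abs_nonneg x) ha1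
    rw [(hd x).deriv]
    linarith [mul_le_mul_of_nonneg_left hcosh ha0]
  simpa using hmono self_mem_Ici hz hz

/-- The derivative of `cosh (θ z) ^ (1 / θ)` with respect to `cosh z`, extended continuously
to `z = 0`. It is the slope of the tangent lines in `cosh_rpow_tangent_le`. -/
noncomputable def coshSlope (θ z : ℝ) : ℝ :=
  if z = 0 then θ else cosh (θ * z) ^ (1 / θ - 1) * sinh (θ * z) / sinh z

theorem coshSlope_mul_sinh (θ z : ℝ) :
    coshSlope θ z * sinh z = cosh (θ * z) ^ (1 / θ - 1) * sinh (θ * z) := by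
  rcases eq_or_ne z 0 with rfl | hz
  · simp
  · rw [coshSlope, if_neg hz, div_mul_cancel₀ _ (sinh_ne_zero.2 hz)]

theorem coshSlope_neg (θ z : ℝ) : coshSlope θ (-z) = coshSlope θ z := by
  simp only [coshSlope, neg_eq_zero, mul_neg, cosh_neg, sinh_neg, neg_div_neg_eq]

variable {θ : ℝ}

theorem hasDerivAt_cosh_rpow_mul_sinh (hθ : θ ≠ 0) (z : ℝ) :
    HasDerivAt (fun z => cosh (θ * z) ^ (1 / θ - 1) * sinh (θ * z))
      (cosh (θ * z) ^ (1 / θ - 2) * (sinh (θ * z) ^ 2 + θ)) z := by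
  refine ((hasDerivAt_cosh_const_mul_rpow θ (1 / θ - 1) z).mul
    (hasDerivAt_sinh_const_mul θ z)).congr_deriv ?_
  have hm : θ * (1 / θ - 1) = 1 - θ := by field_simp
  rw [show 1 / θ - 1 = 1 / θ - 2 + 1 by ring, add_sub_cancel_right, rpow_add_one (cosh_pos _).ne',
    show 1 / θ - 2 + 1 = 1 / θ - 1 by ring, mul_assoc (sinh _) θ, hm]
  linear_combination θ * cosh (θ * z) ^ (1 / θ - 2) * cosh_sq (θ * z)

theorem cosh_mul_sinh_mul_cosh_le (hθ : 1 / 2 ≤ θ) (hθ1 : θ ≤ 1) {z : ℝ} (hz : 0 ≤ z) :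
    cosh (θ * z) * sinh (θ * z) * cosh z ≤ (sinh (θ * z) ^ 2 + θ) * sinh z := by
  have h : sinh ((2 * θ - 1) * z) ≤ (2 * θ - 1) * sinh z :=
    sinh_mul_le_mul_sinh (by linarith) (by linarith) hz
  rw [show (2 * θ - 1) * z = 2 * (θ * z) - z by ring, sinh_sub, sinh_two_mul, cosh_two_mul,
    cosh_sq] at h
  linarith

theorem coshSlope_monotoneOn_Ioi (hθ : 1 / 2 ≤ θ) (hθ1 : θ ≤ 1) :
    MonotoneOn (coshSlope θ) (Ioi 0) := by
  have hd (x : ℝ) (hx : 0 < x) := (hasDerivAt_cosh_rpow_mul_sinh (by linarith : θ ≠ 0) x).div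
    (hasDerivAt_sinh x) (sinh_pos_iff.2 hx).ne'
  have hquot : MonotoneOn (fun x => cosh (θ * x) ^ (1 / θ - 1) * sinh (θ * x) / sinh x)
      (Ioi 0) := by
    refine monotoneOn_of_deriv_nonneg (convex_Ioi 0)
      (fun x hx => (hd x hx).continuousAt.continuousWithinAt)
      (fun x hx => (hd x (interior_subset hx)).differentiableAt.differentiableWithinAt)
      fun x hx => ?_
    have hx0 : 0 < x := interior_subset hx
    have hnum : 0 ≤ cosh (θ * x) ^ (1 / θ - 2) *
        ((sinh (θ * x) ^ 2 + θ) * sinh x - cosh (θ * x) * sinh (θ * x) * cosh x) :=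
      mul_nonneg (rpow_nonneg (cosh_pos _).le _)
        (sub_nonneg.2 (cosh_mul_sinh_mul_cosh_le hθ hθ1 hx0.le))
    refine ((hd x hx0).deriv.trans ?_).ge.trans' (div_nonneg hnum (sq_nonneg (sinh x)))
    rw [show 1 / θ - 1 = 1 / θ - 2 + 1 by ring, rpow_add_one (cosh_pos _).ne']
    ring
  exact hquot.congr fun x (hx : 0 < x) => (if_neg hx.ne').symm

theorem tendsto_coshSlope_nhdsGT_zero (hθ : θ ≠ 0) :
    Tendsto (coshSlope θ) (𝓝[>] 0) (𝓝 θ) := by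
  have hnum := (hasDerivAt_cosh_rpow_mul_sinh hθ 0).tendsto_slope_zero_right
  have hden := (hasDerivAt_sinh 0).tendsto_slope_zero_right
  have hquot := hnum.div hden (by simp)
  simp only [mul_zero, cosh_zero, one_rpow, sinh_zero, zero_pow two_ne_zero, zero_add, one_mul,
    div_one, sub_zero, smul_eq_mul] at hquot
  refine hquot.congr' ?_
  filter_upwards [self_mem_nhdsWithin] with z (hz : 0 < z)
  rw [Pi.div_apply, mul_div_mul_left _ _ (inv_ne_zero hz.ne'), coshSlope, if_neg hz.ne']

theorem coshSlope_monotoneOn_Ici (hθ : 1 / 2 ≤ θ) (hθ1 : θ ≤ 1) :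
    MonotoneOn (coshSlope θ) (Ici 0) := by
  have hmono := coshSlope_monotoneOn_Ioi hθ hθ1
  intro x (hx : 0 ≤ x) y _ hxy
  rcases hx.eq_or_lt with rfl | hx
  · rcases hxy.eq_or_lt with rfl | hy
    · rfl
    · rw [coshSlope, if_pos rfl]
      refine le_of_tendsto (tendsto_coshSlope_nhdsGT_zero (by linarith)) ?_
      filter_upwards [Ioc_mem_nhdsGT hy] with z hz
      exact hmono hz.1 hy hz.2
  · exact hmono hx (hx.trans_le hxy) hxy

theorem exists_coshSlope_mul_eq (hθ : θ ≠ 0) {a b : ℝ} (ha : 0 ≤ a) (hab : a < b) :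
    ∃ c ∈ Ioo a b, cosh (θ * b) ^ (1 / θ) - cosh (θ * a) ^ (1 / θ) =
      coshSlope θ c * (cosh b - cosh a) := by
  obtain ⟨c, hc, h⟩ := exists_ratio_hasDerivAt_eq_ratio_slope
    (fun z => cosh (θ * z) ^ (1 / θ)) _ hab
    (fun x _ => (hasDerivAt_cosh_const_mul_rpow θ (1 / θ) x).continuousAt.continuousWithinAt)
    (fun x _ => hasDerivAt_cosh_const_mul_rpow θ (1 / θ) x) cosh sinh
    continuous_cosh.continuousOn (fun x _ => hasDerivAt_cosh x)
  have hs : sinh c ≠ 0 := (sinh_pos_iff.2 (ha.trans_lt hc.1)).ne'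
  refine ⟨c, hc, mul_right_cancel₀ hs ?_⟩
  rw [mul_right_comm, coshSlope_mul_sinh, ← h]
  field_simp

/-- `cosh (θ z) ^ (1 / θ)` is a convex function of `cosh z`, so it lies above its tangents. -/
theorem cosh_rpow_tangent_le (hθ : 1 / 2 ≤ θ) (hθ1 : θ ≤ 1) (z₀ z : ℝ) :
    cosh (θ * z₀) ^ (1 / θ) + coshSlope θ z₀ * (cosh z - cosh z₀) ≤ cosh (θ * z) ^ (1 / θ) := by
  wlog hz₀ : 0 ≤ z₀ generalizing z₀
  · simpa only [mul_neg, cosh_neg, coshSlope_neg] using this (-z₀) (by linarith)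
  wlog hz : 0 ≤ z generalizing z
  · simpa only [mul_neg, cosh_neg] using this (-z) (by linarith)
  have hθ0 : θ ≠ 0 := by linarith
  have hmono := coshSlope_monotoneOn_Ici hθ hθ1
  have hcosh {a b : ℝ} (ha : 0 ≤ a) (hab : a < b) : 0 ≤ cosh b - cosh a :=
    sub_nonneg.2 (cosh_le_cosh.2 (abs_le_abs_of_nonneg ha hab.le))
  rcases lt_trichotomy z z₀ with h | rfl | h
  · obtain ⟨c, hc, hslope⟩ := exists_coshSlope_mul_eq hθ0 hz h
    have := mul_le_mul_of_nonneg_right (hmono (hz.trans hc.1.le) hz₀ hc.2.le) (hcosh hz h)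
    linarith
  · simp
  · obtain ⟨c, hc, hslope⟩ := exists_coshSlope_mul_eq hθ0 hz₀ h
    have := mul_le_mul_of_nonneg_right (hmono hz₀ (hz₀.trans hc.1.le) hc.1.le) (hcosh hz₀ h)
    linarith

/-- The value of `γ ^ 2` in Oleszkiewicz's two-point inequality between `L^(2 θ)` and `L^2`, for
the weights `p`, `1 - p` with log-odds `ln ((1 - p) / p) = 2 θ z`. At `z = 0`, that is for
`p = 1 / 2`, it is the limit `2 θ - 1` of the quotient. -/
noncomputable def sharpRate (θ z : ℝ) : ℝ :=
  if z = 0 then 2 * θ - 1 else sinh ((2 * θ - 1) * z) / sinh z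

theorem sharpRate_le_one (hθ0 : 0 ≤ θ) (hθ1 : θ ≤ 1) (z : ℝ) : sharpRate θ z ≤ 1 := by
  rw [sharpRate]
  split_ifs
  · linarith
  · refine (le_abs_self _).trans ?_
    rw [abs_div, abs_sinh, abs_sinh, abs_mul]
    refine div_le_one_of_le₀ (sinh_le_sinh.2 ?_) (sinh_nonneg_iff.2 (abs_nonneg z))
    exact mul_le_of_le_one_left (abs_nonneg z) (abs_le.2 ⟨by linarith, by linarith⟩)

theorem two_mul_coshSlope_mul_cosh (θ z : ℝ) :
    2 * coshSlope θ z * cosh z =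
      cosh (θ * z) ^ (1 / θ - 2) * (cosh (θ * z) ^ 2 + sinh (θ * z) ^ 2 + sharpRate θ z) := by
  rcases eq_or_ne z 0 with rfl | hz
  · simp [coshSlope, sharpRate]
  · have hs : sinh z ≠ 0 := sinh_ne_zero.2 hz
    rw [coshSlope, sharpRate, if_neg hz, if_neg hz, show 1 / θ - 1 = 1 / θ - 2 + 1 by ring,
      rpow_add_one (cosh_pos _).ne', show (2 * θ - 1) * z = 2 * (θ * z) - z by ring, sinh_sub,
      sinh_two_mul, cosh_two_mul]
    field_simp
    ring

theorem cosh_rpow_tangent_eq (θ z w : ℝ) :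
    cosh (θ * z) ^ (1 / θ) + coshSlope θ z * (cosh (z + 2 * w) - cosh z) =
      cosh (θ * z) ^ (1 / θ - 2) * (cosh (θ * z + w) ^ 2 + sharpRate θ z * sinh w ^ 2) := by
  have hcosh := two_mul_coshSlope_mul_cosh θ z
  have hsinh := coshSlope_mul_sinh θ z
  have hC : cosh (θ * z) ^ (1 / θ) = cosh (θ * z) ^ (1 / θ - 2) * cosh (θ * z) ^ 2 := by
    rw [← rpow_add_natCast (cosh_pos _).ne']
    norm_num
  rw [show 1 / θ - 1 = 1 / θ - 2 + 1 by ring, rpow_add_one (cosh_pos _).ne'] at hsinh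
  rw [hC, cosh_add, cosh_add, cosh_two_mul, sinh_two_mul]
  linear_combination sinh w ^ 2 * hcosh + 2 * sinh w * cosh w * hsinh +
    (coshSlope θ z * cosh z - cosh (θ * z) ^ (1 / θ - 2) * cosh (θ * z) ^ 2) * cosh_sq w

theorem cosh_sq_add_sharpRate_mul_sinh_sq_le (hθ : 1 / 2 ≤ θ) (hθ1 : θ ≤ 1) (z w : ℝ) :
    cosh (θ * z + w) ^ 2 + sharpRate θ z * sinh w ^ 2 ≤
      cosh (θ * z) ^ 2 * (cosh (θ * (z + 2 * w)) / cosh (θ * z)) ^ (1 / θ) := by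
  have hC := cosh_pos (θ * z)
  have h := cosh_rpow_tangent_le hθ hθ1 z (z + 2 * w)
  rw [cosh_rpow_tangent_eq] at h
  rw [div_rpow (cosh_pos _).le hC.le, mul_div_assoc', le_div_iff₀ (rpow_pos_of_pos hC _)]
  calc (cosh (θ * z + w) ^ 2 + sharpRate θ z * sinh w ^ 2) * cosh (θ * z) ^ (1 / θ)
      = cosh (θ * z) ^ 2 * (cosh (θ * z) ^ (1 / θ - 2) *
          (cosh (θ * z + w) ^ 2 + sharpRate θ z * sinh w ^ 2)) := by
        rw [rpow_sub hC, rpow_two]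
        field_simp
    _ ≤ cosh (θ * z) ^ 2 * cosh (θ * (z + 2 * w)) ^ (1 / θ) := by gcongr

end Hyperbolic

section TwoPoint

/-- The two-point hypercontractive inequality `‖T_γ g‖₂ ≤ ‖g‖_s`, squared, for the function `g`
with value `x` at the point of weight `p` and `y` at the point of weight `1 - p`. Here `r = γ ^ 2`,
and the left-hand side is `‖T_γ g‖₂ ^ 2` written out. -/
def TwoPointIneq (p s r x y : ℝ) : Prop :=
  (p * x + (1 - p) * y) ^ 2 + r * (p * (1 - p)) * (x - y) ^ 2 ≤
    (p * |x| ^ s + (1 - p) * |y| ^ s) ^ (2 / s)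

/-- The log-odds `ln ((1 - p) / p)` of the point of weight `1 - p`. -/
noncomputable def logOdds (p : ℝ) : ℝ := log ((1 - p) / p)

variable {p s r x y : ℝ}

theorem TwoPointIneq.mono {r' : ℝ} (hp0 : 0 ≤ p) (hp1 : p ≤ 1) (hr : r' ≤ r)
    (h : TwoPointIneq p s r x y) : TwoPointIneq p s r' x y := by
  have : 0 ≤ p * (1 - p) := mul_nonneg hp0 (sub_nonneg.2 hp1)
  exact le_trans (by gcongr) h

theorem TwoPointIneq.of_abs (hp0 : 0 ≤ p) (hp1 : p ≤ 1) (hr : r ≤ 1)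
    (h : TwoPointIneq p s r |x| |y|) : TwoPointIneq p s r x y := by
  rw [TwoPointIneq, abs_abs, abs_abs] at h
  refine le_trans ?_ h
  have hxy : x * y ≤ |x| * |y| := (le_abs_self _).trans (abs_mul x y).le
  have hcoeff : 0 ≤ 2 * (p * (1 - p) * (1 - r)) := by
    have := sub_nonneg.2 hp1
    have := sub_nonneg.2 hr
    positivity
  have hexpand (x y : ℝ) : (p * x + (1 - p) * y) ^ 2 + r * (p * (1 - p)) * (x - y) ^ 2 =
      (p ^ 2 + r * (p * (1 - p))) * x ^ 2 + ((1 - p) ^ 2 + r * (p * (1 - p))) * y ^ 2 +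
        2 * (p * (1 - p) * (1 - r)) * (x * y) := by ring
  rw [hexpand, hexpand, sq_abs, sq_abs]
  linarith [mul_le_mul_of_nonneg_left hxy hcoeff]

theorem isClosed_setOf_twoPointIneq (p r : ℝ) (hs : 0 ≤ s) :
    IsClosed {z : ℝ × ℝ | TwoPointIneq p s r z.1 z.2} := by
  have : Continuous fun z : ℝ × ℝ => |z.1| ^ s :=
    continuous_fst.abs.rpow_const fun _ => Or.inr hs
  have : Continuous fun z : ℝ × ℝ => |z.2| ^ s :=
    continuous_snd.abs.rpow_const fun _ => Or.inr hs
  refine isClosed_le (by fun_prop) (Continuous.rpow_const (by fun_prop) fun _ => Or.inr ?_)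
  positivity

theorem TwoPointIneq.of_pos (hp0 : 0 ≤ p) (hp1 : p ≤ 1) (hs : 0 ≤ s) (hr : r ≤ 1)
    (h : ∀ x y, 0 < x → 0 < y → TwoPointIneq p s r x y) (x y : ℝ) : TwoPointIneq p s r x y := by
  refine .of_abs hp0 hp1 hr ?_
  have hsub : Ioi (0 : ℝ) ×ˢ Ioi (0 : ℝ) ⊆ {z | TwoPointIneq p s r z.1 z.2} :=
    fun z hz => h z.1 z.2 hz.1 hz.2
  have hclosure := closure_minimal hsub (isClosed_setOf_twoPointIneq p r hs)
  rw [closure_prod_eq, closure_Ioi] at hclosure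
  exact hclosure (mk_mem_prod (abs_nonneg x) (abs_nonneg y))

theorem exp_logOdds (hp0 : 0 < p) (hp1 : p < 1) : exp (logOdds p) = (1 - p) / p :=
  exp_log (div_pos (sub_pos.2 hp1) hp0)

theorem eq_exp_div_cosh_logOdds (hp0 : 0 < p) (hp1 : p < 1) :
    p = exp (-(logOdds p / 2)) / (2 * cosh (logOdds p / 2)) := by
  have hexp : exp (logOdds p / 2) = exp (-(logOdds p / 2)) * ((1 - p) / p) := by
    rw [← exp_logOdds hp0 hp1, ← exp_add]
    ring_nf
  rw [cosh_eq, hexp]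
  field_simp
  ring

theorem one_sub_eq_exp_div_cosh_logOdds (hp0 : 0 < p) (hp1 : p < 1) :
    1 - p = exp (logOdds p / 2) / (2 * cosh (logOdds p / 2)) := by
  have := cosh_pos (logOdds p / 2)
  have h := eq_exp_div_cosh_logOdds hp0 hp1
  rw [eq_div_iff (by positivity)] at h ⊢
  linear_combination 2 * cosh_eq (logOdds p / 2) - h

theorem mul_one_sub_eq_inv_cosh_sq_logOdds (hp0 : 0 < p) (hp1 : p < 1) :
    p * (1 - p) = 1 / (2 * cosh (logOdds p / 2)) ^ 2 := by
  conv_lhs => rw [one_sub_eq_exp_div_cosh_logOdds hp0 hp1]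
  conv_lhs => enter [1]; rw [eq_exp_div_cosh_logOdds hp0 hp1]
  rw [div_mul_div_comm, ← exp_add, neg_add_cancel, exp_zero, sq]

theorem mul_exp_neg_add_mul_exp (hp0 : 0 < p) (hp1 : p < 1) (w : ℝ) :
    p * exp (-w) + (1 - p) * exp w = cosh (logOdds p / 2 + w) / cosh (logOdds p / 2) := by
  conv_lhs => rw [one_sub_eq_exp_div_cosh_logOdds hp0 hp1]
  conv_lhs => enter [1, 1]; rw [eq_exp_div_cosh_logOdds hp0 hp1]
  rw [cosh_eq (_ + w), neg_add, exp_add, exp_add]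
  field_simp
  ring

theorem exists_eq_mul_exp_neg_and_eq_mul_exp (hx : 0 < x) (hy : 0 < y) :
    ∃ c w : ℝ, 0 < c ∧ x = c * exp (-w) ∧ y = c * exp w := by
  refine ⟨exp ((log x + log y) / 2), (log y - log x) / 2, exp_pos _, ?_, ?_⟩
  · rw [← exp_add, show (log x + log y) / 2 + -((log y - log x) / 2) = log x by ring, exp_log hx]
  · rw [← exp_add, show (log x + log y) / 2 + (log y - log x) / 2 = log y by ring, exp_log hy]

theorem twoPointIneq_sharpRate_of_pos (hp0 : 0 < p) (hp1 : p < 1) (hs1 : 1 ≤ s) (hs2 : s ≤ 2)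
    (hx : 0 < x) (hy : 0 < y) : TwoPointIneq p s (sharpRate (s / 2) (logOdds p / s)) x y := by
  obtain ⟨c, w, hc, rfl, rfl⟩ := exists_eq_mul_exp_neg_and_eq_mul_exp hx hy
  have hs : 0 < s := by linarith
  have hyp := cosh_sq_add_sharpRate_mul_sinh_sq_le (θ := s / 2) (by linarith) (by linarith)
    (logOdds p / s) w
  rw [show s / 2 * (logOdds p / s) = logOdds p / 2 by field_simp,
    show s / 2 * (logOdds p / s + 2 * w) = logOdds p / 2 + s * w by field_simp,
    one_div_div] at hyp
  set r := sharpRate (s / 2) (logOdds p / s)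
  set C := cosh (logOdds p / 2) with hC
  have hC0 : 0 < C := cosh_pos _
  have hmean : p * (c * exp (-w)) + (1 - p) * (c * exp w) = c * (cosh (logOdds p / 2 + w) / C) := by
    rw [hC, ← mul_exp_neg_add_mul_exp hp0 hp1]
    ring
  have hmoment : p * |c * exp (-w)| ^ s + (1 - p) * |c * exp w| ^ s =
      c ^ s * (cosh (logOdds p / 2 + s * w) / C) := by
    rw [hC, ← mul_exp_neg_add_mul_exp hp0 hp1, abs_of_pos hx, abs_of_pos hy,
      mul_rpow hc.le (exp_pos _).le, mul_rpow hc.le (exp_pos _).le, ← exp_mul, ← exp_mul,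
      neg_mul, mul_comm w]
    ring
  have hdiff : c * exp (-w) - c * exp w = -(2 * c * sinh w) := by
    rw [sinh_eq]
    ring
  rw [TwoPointIneq, hmean, hmoment, hdiff, mul_one_sub_eq_inv_cosh_sq_logOdds hp0 hp1, ← hC,
    mul_rpow (by positivity) (div_nonneg (cosh_pos _).le hC0.le), ← rpow_mul hc.le,
    mul_div_cancel₀ _ hs.ne', rpow_two]
  calc (c * (cosh (logOdds p / 2 + w) / C)) ^ 2 + r * (1 / (2 * C) ^ 2) * (-(2 * c * sinh w)) ^ 2
      = c ^ 2 * ((cosh (logOdds p / 2 + w) ^ 2 + r * sinh w ^ 2) / C ^ 2) := by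
        field_simp
    _ ≤ c ^ 2 * (cosh (logOdds p / 2 + s * w) / C) ^ (2 / s) := by
        gcongr
        rwa [div_le_iff₀' (by positivity)]

theorem twoPointIneq_sharpRate (hp0 : 0 < p) (hp1 : p < 1) (hs1 : 1 ≤ s) (hs2 : s ≤ 2)
    (x y : ℝ) : TwoPointIneq p s (sharpRate (s / 2) (logOdds p / s)) x y :=
  .of_pos hp0.le hp1.le (by linarith) (sharpRate_le_one (by linarith) (by linarith) _)
    (fun _ _ => twoPointIneq_sharpRate_of_pos hp0 hp1 hs1 hs2) x y

end TwoPoint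

section Rates

theorem sharpRate_neg (θ z : ℝ) : sharpRate θ (-z) = sharpRate θ z := by
  simp only [sharpRate, neg_eq_zero, mul_neg, sinh_neg, neg_div_neg_eq]

/-- Bernoulli's inequality for `(1 + (exp (-2 k) - 1)) ^ r`, in hyperbolic form. -/
theorem exp_mul_sinh_mul_le {r : ℝ} (hr : 1 ≤ r) (k : ℝ) :
    exp (-((r - 1) * k)) * sinh (r * k) ≤ r * sinh k := by
  have hbernoulli : 1 + r * (exp (-(2 * k)) - 1) ≤ exp (-(2 * k) * r) := by
    have h := one_add_mul_self_le_rpow_one_add (s := exp (-(2 * k)) - 1)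
      (by linarith [exp_pos (-(2 * k))]) hr
    rwa [add_sub_cancel, ← exp_mul] at h
  calc exp (-((r - 1) * k)) * sinh (r * k)
      = exp k * (1 - exp (-(2 * k) * r)) / 2 := by
        rw [sinh_eq, mul_div_assoc', mul_sub, mul_sub, ← exp_add, ← exp_add, ← exp_add]
        ring_nf
    _ ≤ exp k * (r * (1 - exp (-(2 * k)))) / 2 := by
        gcongr
        linarith
    _ = r * sinh k := by
        rw [sinh_eq, show -k = k + -(2 * k) by ring, exp_add]
        ring

variable {p : ℝ}

theorem minProb_pos (hp0 : 0 < p) (hp1 : p < 1) : 0 < minProb p := lt_min hp0 (sub_pos.2 hp1)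

theorem minProb_le_half (p : ℝ) : minProb p ≤ 1 / 2 := by
  rw [minProb, min_le_iff]
  by_contra! h
  linarith [h.1, h.2]

theorem odds_minProb_pos (hp0 : 0 < p) (hp1 : p < 1) : 0 < minProb p / (1 - minProb p) :=
  div_pos (minProb_pos hp0 hp1) (by linarith [minProb_le_half p])

theorem odds_minProb_le_one (p : ℝ) : minProb p / (1 - minProb p) ≤ 1 := by
  have := minProb_le_half p
  rw [div_le_one (by linarith)]
  linarith

theorem log_odds_minProb_eq (p : ℝ) :
    log (minProb p / (1 - minProb p)) = logOdds p ∨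
    log (minProb p / (1 - minProb p)) = -logOdds p := by
  rw [logOdds, ← log_inv, inv_div, minProb]
  rcases min_choice p (1 - p) with h | h
  · exact Or.inr (by rw [h])
  · exact Or.inl (by rw [h, sub_sub_cancel])

theorem log_odds_minProb_neg (hp0 : 0 < p) (hp1 : p < 1) (hp : p ≠ 1 / 2) :
    log (minProb p / (1 - minProb p)) < 0 := by
  refine log_neg (odds_minProb_pos hp0 hp1) ((odds_minProb_le_one p).lt_of_ne fun h => hp ?_)
  rw [div_eq_one_iff_eq (by linarith [minProb_le_half p]), minProb] at h
  rcases min_choice p (1 - p) with hmin | hmin <;> rw [hmin] at h <;> linarith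

theorem sharpRate_log_odds_minProb (θ s p : ℝ) :
    sharpRate θ (-log (minProb p / (1 - minProb p)) / s) = sharpRate θ (logOdds p / s) := by
  rcases log_odds_minProb_eq p with h | h <;> rw [h]
  · rw [neg_div, sharpRate_neg]
  · rw [neg_neg]

theorem rhoOne_rhoSinh_mul_self_sq (hp0 : 0 < p) (hp1 : p < 1) (δ : ℝ) :
    (rhoOne (rhoSinh p) δ * δ) ^ 2 = sharpRate ((1 + δ ^ 2) / 2) (logOdds p / (1 + δ ^ 2)) := by
  rcases eq_or_ne δ 0 with rfl | hδ
  · simp [sharpRate]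
  rw [← sharpRate_log_odds_minProb, rhoOne, rhoSinh]
  split_ifs with hp
  · norm_num [hp, sharpRate, minProb]
    ring
  have hlog := log_odds_minProb_neg hp0 hp1 hp
  set ℓ := log (minProb p / (1 - minProb p))
  have hz : 0 < -ℓ / (1 + δ ^ 2) := div_pos (neg_pos.2 hlog) (by positivity)
  have hnum : -(1 / (1 / δ ^ 2 + 1)) * ℓ = (2 * ((1 + δ ^ 2) / 2) - 1) * (-ℓ / (1 + δ ^ 2)) := by
    field_simp
    ring
  have hden : -(1 - 1 / (1 / δ ^ 2 + 1)) * ℓ = -ℓ / (1 + δ ^ 2) := by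
    field_simp
    ring
  have hquot : 0 ≤ sinh ((2 * ((1 + δ ^ 2) / 2) - 1) * (-ℓ / (1 + δ ^ 2))) /
      sinh (-ℓ / (1 + δ ^ 2)) := by
    refine div_nonneg (sinh_nonneg_iff.2 (mul_nonneg ?_ hz.le)) (sinh_nonneg_iff.2 hz.le)
    linarith [sq_nonneg δ]
  rw [sharpRate, if_neg hz.ne', hnum, hden, add_sub_cancel_right, mul_pow, mul_pow,
    sq_sqrt (by positivity), sq_sqrt hquot]
  field_simp

theorem odds_minProb_rpow_le_rhoSinh (hp0 : 0 < p) (hp1 : p < 1) {q : ℝ} (hq : 2 ≤ q) :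
    (minProb p / (1 - minProb p)) ^ (1 / 2 - 1 / q) ≤ rhoSinh p q := by
  rw [rhoSinh]
  split_ifs with hp
  · norm_num [hp, minProb]
  have hlog := log_odds_minProb_neg hp0 hp1 hp
  have hodds := odds_minProb_pos hp0 hp1
  have hsinh : 0 < sinh (-(1 - 1 / q) * log (minProb p / (1 - minProb p))) := by
    refine sinh_pos_iff.2 (mul_pos_of_neg_of_neg (neg_neg_of_pos (sub_pos.2 ?_)) hlog)
    rw [div_lt_one (by linarith)]
    linarith
  have hsq : ((minProb p / (1 - minProb p)) ^ (1 / 2 - 1 / q)) ^ 2 =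
      exp (-((q - 1 - 1) * (-(1 / q) * log (minProb p / (1 - minProb p))))) := by
    rw [← rpow_mul_natCast hodds.le, rpow_def_of_pos hodds]
    congr 1
    push_cast
    field_simp
    ring
  have hbernoulli := exp_mul_sinh_mul_le (r := q - 1) (by linarith)
    (-(1 / q) * log (minProb p / (1 - minProb p)))
  rw [← hsq, show (q - 1) * (-(1 / q) * log (minProb p / (1 - minProb p))) =
    -(1 - 1 / q) * log (minProb p / (1 - minProb p)) by field_simp] at hbernoulli
  rw [← sqrt_mul (by linarith)]
  refine le_sqrt_of_sq_le ?_
  rwa [mul_div_assoc', le_div_iff₀ hsinh]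

theorem rhoPower_le_rhoSinh (hp0 : 0 < p) (hp1 : p < 1) {q : ℝ} (hq : 2 ≤ q) :
    rhoPower p q ≤ rhoSinh p q := by
  have hmin := minProb_pos hp0 hp1
  have hexponent : 0 ≤ 1 / 2 - 1 / q := sub_nonneg.2 (one_div_le_one_div_of_le two_pos hq)
  refine (rpow_le_rpow hmin.le ?_ hexponent).trans (odds_minProb_rpow_le_rhoSinh hp0 hp1 hq)
  exact le_div_self hmin.le (by linarith [minProb_le_half p]) (by linarith)

theorem rhoRatio_le_rhoSinh (hp0 : 0 < p) (hp1 : p < 1) {q : ℝ} (hq : 2 ≤ q) :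
    rhoRatio p q ≤ rhoSinh p q := by
  rw [rhoRatio, sqrt_eq_rpow]
  refine (rpow_le_rpow_of_exponent_ge (odds_minProb_pos hp0 hp1) (odds_minProb_le_one p) ?_).trans
    (odds_minProb_rpow_le_rhoSinh hp0 hp1 hq)
  exact sub_le_self _ (by positivity)

theorem abs_le_rhoSinh_of_mem {ρ : ℝ → ℝ} (hp0 : 0 < p) (hp1 : p < 1)
    (hρ : ρ = rhoPower p ∨ ρ = rhoSinh p ∨ ρ = rhoRatio p) {q : ℝ} (hq : 2 ≤ q) :
    |ρ q| ≤ rhoSinh p q := by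
  rcases hρ with rfl | rfl | rfl
  · exact (abs_of_nonneg (rpow_nonneg (minProb_pos hp0 hp1).le _)).trans_le
      (rhoPower_le_rhoSinh hp0 hp1 hq)
  · exact (abs_of_nonneg ((rpow_nonneg (odds_minProb_pos hp0 hp1).le _).trans
      (odds_minProb_rpow_le_rhoSinh hp0 hp1 hq))).le
  · exact (abs_of_nonneg (sqrt_nonneg _)).trans_le (rhoRatio_le_rhoSinh hp0 hp1 hq)

end Rates

section Tensorization

theorem Lp_sum_le {ι κ : Type*} (s : Finset ι) (t : Finset κ) (f : κ → ι → ℝ) {r : ℝ}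
    (hr : 1 ≤ r) :
    (∑ i ∈ s, |∑ k ∈ t, f k i| ^ r) ^ (1 / r) ≤ ∑ k ∈ t, (∑ i ∈ s, |f k i| ^ r) ^ (1 / r) := by
  have hr0 : r ≠ 0 := by linarith
  simpa only [Finset.sum_apply] using Finset.le_sum_of_subadditive
    (fun u : ι → ℝ => (∑ i ∈ s, |u i| ^ r) ^ (1 / r)) (by simp [hr0])
    (fun u v => Lp_add_le s u v hr) t f

variable {α β : Type*} [Fintype α] [Fintype β]

/-- Minkowski's integral inequality, for finite weighted sums. -/
theorem sum_mul_sum_mul_rpow_le {w : α → ℝ} {W : β → ℝ} (hw : ∀ a, 0 ≤ w a) (hW : ∀ x, 0 ≤ W x)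
    {r : ℝ} (hr : 1 ≤ r) {u : α → β → ℝ} (hu : ∀ a x, 0 ≤ u a x) :
    ∑ x, W x * (∑ a, w a * u a x) ^ r ≤ (∑ a, w a * (∑ x, W x * u a x ^ r) ^ (1 / r)) ^ r := by
  have hr0 : 0 < r := by linarith
  have hsum (x : β) : 0 ≤ ∑ a, w a * u a x :=
    Finset.sum_nonneg fun a _ => mul_nonneg (hw a) (hu a x)
  have hpow (a : α) (x : β) :
      |W x ^ (1 / r) * (w a * u a x)| ^ r = w a ^ r * (W x * u a x ^ r) := by
    have := hw a
    have := hW x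
    have := hu a x
    rw [abs_of_nonneg (by positivity), mul_rpow (by positivity) (by positivity),
      mul_rpow (hw a) (hu a x), ← rpow_mul (hW x), one_div_mul_cancel hr0.ne', rpow_one]
    ring
  have hleft (x : β) : |∑ a, W x ^ (1 / r) * (w a * u a x)| ^ r =
      W x * (∑ a, w a * u a x) ^ r := by
    rw [← Finset.mul_sum, abs_of_nonneg (mul_nonneg (rpow_nonneg (hW x) _) (hsum x)),
      mul_rpow (rpow_nonneg (hW x) _) (hsum x), ← rpow_mul (hW x), one_div_mul_cancel hr0.ne',
      rpow_one]
  have hright (a : α) : (∑ x, |W x ^ (1 / r) * (w a * u a x)| ^ r) ^ (1 / r) =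
      w a * (∑ x, W x * u a x ^ r) ^ (1 / r) := by
    simp only [hpow]
    rw [← Finset.mul_sum, mul_rpow (rpow_nonneg (hw a) _)
      (Finset.sum_nonneg fun x _ => mul_nonneg (hW x) (rpow_nonneg (hu a x) _)),
      ← rpow_mul (hw a), mul_one_div_cancel hr0.ne', rpow_one]
  have hminkowski := Lp_sum_le Finset.univ Finset.univ
    (fun a x => W x ^ (1 / r) * (w a * u a x)) hr
  simp only [hleft, hright] at hminkowski
  have h0 : 0 ≤ ∑ x, W x * (∑ a, w a * u a x) ^ r :=
    Finset.sum_nonneg fun x _ => mul_nonneg (hW x) (rpow_nonneg (hsum x) _)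
  have h1 : 0 ≤ ∑ a, w a * (∑ x, W x * u a x ^ r) ^ (1 / r) :=
    Finset.sum_nonneg fun a _ => mul_nonneg (hw a) (rpow_nonneg
      (Finset.sum_nonneg fun x _ => mul_nonneg (hW x) (rpow_nonneg (hu a x) _)) _)
  exact (rpow_inv_le_iff_of_pos h0 h1 hr0).1 (by rwa [← one_div])

/-- The operator with kernel `k` is a contraction from `L^s` to `L^t` of the weight `w`; both norms
are raised to the power `t`. -/
def LpContractive (w : α → ℝ) (k : α → α → ℝ) (s t : ℝ) : Prop :=
  ∀ g : α → ℝ, ∑ a, w a * |∑ b, k a b * g b| ^ t ≤ (∑ a, w a * |g a| ^ s) ^ (t / s)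

variable {w : α → ℝ} {W : β → ℝ} {k : α → α → ℝ} {K : β → β → ℝ} {s t : ℝ}

theorem LpContractive.prod (hw : ∀ a, 0 ≤ w a) (hW : ∀ x, 0 ≤ W x) (hs : 0 < s) (hst : s ≤ t)
    (hk : LpContractive w k s t) (hK : LpContractive W K s t) :
    LpContractive (fun z : α × β => w z.1 * W z.2) (fun z z' => k z.1 z'.1 * K z.2 z'.2) s t := by
  intro f
  let g (a : α) (x : β) : ℝ := ∑ y, K x y * f (a, y)
  have hinner (a : α) (x : β) : ∑ z : α × β, k a z.1 * K x z.2 * f z = ∑ b, k a b * g b x := by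
    simp only [Fintype.sum_prod_type, g, Finset.mul_sum, mul_assoc]
  have hpow (a : α) (x : β) : (|g a x| ^ s) ^ (t / s) = |g a x| ^ t := by
    rw [← rpow_mul (abs_nonneg _), mul_div_cancel₀ _ hs.ne']
  have hg (a : α) : 0 ≤ ∑ x, W x * |g a x| ^ t :=
    Finset.sum_nonneg fun x _ => mul_nonneg (hW x) (rpow_nonneg (abs_nonneg _) _)
  have hK' (a : α) : (∑ x, W x * |g a x| ^ t) ^ (1 / (t / s)) ≤ ∑ x, W x * |f (a, x)| ^ s := by
    rw [one_div, rpow_inv_le_iff_of_pos (hg a)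
      (Finset.sum_nonneg fun x _ => mul_nonneg (hW x) (rpow_nonneg (abs_nonneg _) _))
      (div_pos (hs.trans_le hst) hs)]
    exact hK fun y => f (a, y)
  calc ∑ z : α × β, w z.1 * W z.2 * |∑ z' : α × β, k z.1 z'.1 * K z.2 z'.2 * f z'| ^ t
      = ∑ x, W x * ∑ a, w a * |∑ b, k a b * g b x| ^ t := by
        rw [Fintype.sum_prod_type_right]
        simp only [hinner]
        simp only [Finset.mul_sum, mul_left_comm, mul_assoc]
    _ ≤ ∑ x, W x * (∑ a, w a * |g a x| ^ s) ^ (t / s) :=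
        Finset.sum_le_sum fun x _ => mul_le_mul_of_nonneg_left (hk fun b => g b x) (hW x)
    _ ≤ (∑ a, w a * (∑ x, W x * |g a x| ^ t) ^ (1 / (t / s))) ^ (t / s) := by
        simpa only [hpow] using sum_mul_sum_mul_rpow_le hw hW ((one_le_div hs).2 hst)
          fun a x => rpow_nonneg (abs_nonneg (g a x)) s
    _ ≤ (∑ a, w a * ∑ x, W x * |f (a, x)| ^ s) ^ (t / s) := by
        refine rpow_le_rpow (Finset.sum_nonneg fun a _ => mul_nonneg (hw a)
          (rpow_nonneg (hg a) _)) ?_ (div_nonneg (hs.le.trans hst) hs.le)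
        exact Finset.sum_le_sum fun a _ => mul_le_mul_of_nonneg_left (hK' a) (hw a)
    _ = (∑ z : α × β, w z.1 * W z.2 * |f z| ^ s) ^ (t / s) := by
        simp only [Fintype.sum_prod_type, Finset.mul_sum, mul_assoc]

theorem LpContractive.pi (hw : ∀ a, 0 ≤ w a) (hs : 0 < s) (hst : s ≤ t)
    (hk : LpContractive w k s t) (n : ℕ) :
    LpContractive (fun x : Fin n → α => ∏ i, w (x i)) (fun x y => ∏ i, k (x i) (y i)) s t := by
  induction n with
  | zero =>
    intro f
    simp [← rpow_mul (abs_nonneg _), mul_div_cancel₀ _ hs.ne']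
  | succ n ih =>
    intro f
    have hprod := hk.prod hw (fun x => Finset.prod_nonneg fun i _ => hw (x i)) hs hst ih
      (f ∘ Fin.consEquiv fun _ => α)
    simp only [← (Fin.consEquiv fun _ => α).sum_comp, Fin.prod_univ_succ]
    exact hprod

end Tensorization

section BiasedCube

variable {p : ℝ}

theorem sum_intUnits (F : ℤˣ → ℝ) : ∑ b, F b = F 1 + F (-1) := by
  rw [UnitsInt.univ, Finset.sum_pair (by decide)]

theorem bitWeight_one (p : ℝ) : bitWeight p 1 = p := if_pos rfl

theorem bitWeight_neg_one (p : ℝ) : bitWeight p (-1) = 1 - p := if_neg (by decide)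

theorem bitChar_one (p : ℝ) : bitChar p 1 = √((1 - p) / p) := if_pos rfl

theorem bitChar_neg_one (p : ℝ) : bitChar p (-1) = -√(p / (1 - p)) := if_neg (by decide)

theorem bitWeight_nonneg (hp0 : 0 ≤ p) (hp1 : p ≤ 1) (b : ℤˣ) : 0 ≤ bitWeight p b := by
  rw [bitWeight]
  split_ifs <;> linarith

theorem mul_sqrt_div {a b : ℝ} (ha : 0 < a) : a * √(b / a) = √(a * b) := by
  rw [show a * b = a ^ 2 * (b / a) by field_simp, sqrt_mul (sq_nonneg a), sqrt_sq ha.le]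

theorem sum_bitWeight_mul_bitChar_mul (hp0 : 0 < p) (hp1 : p < 1) (g : ℤˣ → ℝ) :
    ∑ b, bitWeight p b * bitChar p b * g b = √(p * (1 - p)) * (g 1 - g (-1)) := by
  rw [sum_intUnits, bitWeight_one, bitWeight_neg_one, bitChar_one, bitChar_neg_one, mul_neg,
    mul_sqrt_div hp0, mul_sqrt_div (sub_pos.2 hp1), mul_comm (1 - p) p]
  ring

theorem sum_bitWeight (p : ℝ) : ∑ b, bitWeight p b = 1 := by
  rw [sum_intUnits, bitWeight_one, bitWeight_neg_one, add_sub_cancel]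

theorem sum_bitWeight_mul_bitChar (hp0 : 0 < p) (hp1 : p < 1) :
    ∑ b, bitWeight p b * bitChar p b = 0 := by
  simpa using sum_bitWeight_mul_bitChar_mul hp0 hp1 1

theorem sum_bitWeight_mul_bitChar_sq (hp0 : 0 < p) (hp1 : p < 1) :
    ∑ b, bitWeight p b * bitChar p b ^ 2 = 1 := by
  have := sub_pos.2 hp1
  rw [sum_intUnits, bitWeight_one, bitWeight_neg_one, bitChar_one, bitChar_neg_one, neg_sq,
    sq_sqrt (by positivity), sq_sqrt (by positivity)]
  field_simp
  ring

/-- The kernel of `T_γ` on one coordinate, including the weight of the integration variable. -/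
noncomputable def bitKernel (p γ : ℝ) (a b : ℤˣ) : ℝ :=
  (1 + γ * bitChar p a * bitChar p b) * bitWeight p b

theorem smoothing_eq_sum_bitKernel (p γ : ℝ) {n : ℕ} (f : Cube n → ℝ) (x : Cube n) :
    smoothing p γ f x = ∑ y, (∏ i, bitKernel p γ (x i) (y i)) * f y := by
  have hexpand (y : Cube n) : ∏ i, (1 + γ * bitChar p (x i) * bitChar p (y i)) =
      ∑ S : Finset (Fin n), γ ^ S.card * biasedChar p S x * biasedChar p S y := by
    simp only [Finset.prod_one_add, Finset.powerset_univ, Finset.prod_mul_distrib,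
      Finset.prod_const, biasedChar]
  simp only [bitKernel, Finset.prod_mul_distrib, hexpand, smoothing, biasedFourier, biasedWeight,
    Finset.mul_sum, Finset.sum_mul]
  rw [Finset.sum_comm]
  exact Finset.sum_congr rfl fun y _ => Finset.sum_congr rfl fun S _ => by ring

theorem sum_bitWeight_mul_sum_bitKernel_sq (hp0 : 0 < p) (hp1 : p < 1) (γ : ℝ) (g : ℤˣ → ℝ) :
    ∑ a, bitWeight p a * (∑ b, bitKernel p γ a b * g b) ^ 2 =
      (p * g 1 + (1 - p) * g (-1)) ^ 2 + γ ^ 2 * (p * (1 - p)) * (g 1 - g (-1)) ^ 2 := by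
  set E := p * g 1 + (1 - p) * g (-1)
  set D := √(p * (1 - p)) * (g 1 - g (-1)) with hD
  have hkernel (a : ℤˣ) : ∑ b, bitKernel p γ a b * g b = E + γ * D * bitChar p a := by
    have hmean : ∑ b, bitWeight p b * g b = E := by
      rw [sum_intUnits, bitWeight_one, bitWeight_neg_one]
    rw [← hmean, hD, ← sum_bitWeight_mul_bitChar_mul hp0 hp1, Finset.mul_sum, Finset.sum_mul,
      ← Finset.sum_add_distrib]
    exact Finset.sum_congr rfl fun b _ => by rw [bitKernel]; ring
  calc ∑ a, bitWeight p a * (∑ b, bitKernel p γ a b * g b) ^ 2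
      = E ^ 2 * ∑ a, bitWeight p a + 2 * E * (γ * D) * ∑ a, bitWeight p a * bitChar p a +
          (γ * D) ^ 2 * ∑ a, bitWeight p a * bitChar p a ^ 2 := by
        simp only [hkernel, Finset.mul_sum, ← Finset.sum_add_distrib]
        exact Finset.sum_congr rfl fun a _ => by ring
    _ = E ^ 2 + γ ^ 2 * (p * (1 - p)) * (g 1 - g (-1)) ^ 2 := by
        rw [sum_bitWeight, sum_bitWeight_mul_bitChar hp0 hp1, sum_bitWeight_mul_bitChar_sq hp0 hp1,
          hD, mul_pow, mul_pow, sq_sqrt (mul_pos hp0 (sub_pos.2 hp1)).le]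
        ring

theorem lpContractive_bitKernel (hp0 : 0 < p) (hp1 : p < 1) {s γ : ℝ}
    (h : ∀ x y, TwoPointIneq p s (γ ^ 2) x y) :
    LpContractive (bitWeight p) (bitKernel p γ) s 2 := by
  intro g
  simp only [rpow_two, sq_abs]
  rw [sum_bitWeight_mul_sum_bitKernel_sq hp0 hp1, sum_intUnits, bitWeight_one, bitWeight_neg_one]
  exact h (g 1) (g (-1))

theorem biasedNorm_smoothing_le (hp0 : 0 < p) (hp1 : p < 1) {s γ : ℝ} (hs0 : 0 < s) (hs2 : s ≤ 2)
    (h : ∀ x y, TwoPointIneq p s (γ ^ 2) x y) {n : ℕ} (f : Cube n → ℝ) :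
    biasedNorm p 2 (smoothing p γ f) ≤ biasedNorm p s f := by
  have hweight (x : Cube n) : 0 ≤ biasedWeight p x :=
    Finset.prod_nonneg fun i _ => bitWeight_nonneg hp0.le hp1.le (x i)
  have hmoment (g : Cube n → ℝ) (q : ℝ) : 0 ≤ ∑ x, |g x| ^ q * biasedWeight p x :=
    Finset.sum_nonneg fun x _ => mul_nonneg (rpow_nonneg (abs_nonneg _) _) (hweight x)
  have hcontractive : ∑ x, |smoothing p γ f x| ^ (2 : ℝ) * biasedWeight p x ≤
      (∑ x, |f x| ^ s * biasedWeight p x) ^ (2 / s) := by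
    simpa only [smoothing_eq_sum_bitKernel, biasedWeight, mul_comm] using
      (lpContractive_bitKernel hp0 hp1 h).pi (bitWeight_nonneg hp0.le hp1.le) hs0 hs2 n f
  rw [biasedNorm, biasedNorm, one_div, rpow_inv_le_iff_of_pos (hmoment _ _)
    (rpow_nonneg (hmoment _ _) _) two_pos, ← rpow_mul (hmoment _ _), one_div_mul_eq_div]
  exact hcontractive

end BiasedCube

theorem sq_rhoOne_mul_self_le_of_abs_le {ρ ρ' : ℝ → ℝ} (h : ∀ q, 2 ≤ q → |ρ q| ≤ ρ' q) {δ : ℝ}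
    (hδ : |δ| ≤ 1) : (rhoOne ρ δ * δ) ^ 2 ≤ (rhoOne ρ' δ * δ) ^ 2 := by
  rcases eq_or_ne δ 0 with rfl | hδ0
  · simp only [mul_zero, le_refl]
  have hq : 2 ≤ 1 / δ ^ 2 + 1 := by
    linarith [one_le_one_div (sq_pos_of_ne_zero hδ0) ((sq_le_one_iff_abs_le_one δ).2 hδ)]
  rw [mul_pow, mul_pow]
  gcongr ?_ * _
  exact sq_le_sq.2 ((h _ hq).trans (le_abs_self _))

theorem corollary3_general (p : ℝ) (hp0 : 0 < p) (hp1 : p < 1) (ρ : ℝ → ℝ)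
    (hρ : ∀ q, 2 ≤ q → |ρ q| ≤ rhoSinh p q) (n : ℕ) (f : Cube n → ℝ) (δ : ℝ) (hδ : |δ| ≤ 1) :
    biasedNorm p 2 (smoothing p (rhoOne ρ δ * δ) f) ≤ biasedNorm p (1 + δ ^ 2) f := by
  have hsq : δ ^ 2 ≤ 1 := (sq_le_one_iff_abs_le_one δ).2 hδ
  have hrate : (rhoOne ρ δ * δ) ^ 2 ≤
      sharpRate ((1 + δ ^ 2) / 2) (logOdds p / (1 + δ ^ 2)) :=
    (sq_rhoOne_mul_self_le_of_abs_le hρ hδ).trans_eq (rhoOne_rhoSinh_mul_self_sq hp0 hp1 δ)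
  refine biasedNorm_smoothing_le hp0 hp1 (by positivity) (by linarith) (fun x y => ?_) f
  exact (twoPointIneq_sharpRate hp0 hp1 (by linarith [sq_nonneg δ]) (by linarith) x y).mono
    hp0.le hp1.le hrate

theorem corollary3 (p : ℝ) (hp0 : 0 < p) (hp1 : p < 1) (ρ : ℝ → ℝ)
    (hρ : ρ = rhoPower p ∨ ρ = rhoSinh p ∨ ρ = rhoRatio p)
    (n : ℕ) (f : Cube n → ℝ) (δ : ℝ) (hδ0 : 0 ≤ δ) (hδ1 : δ ≤ 1) :
    biasedNorm p 2 (smoothing p (rhoOne ρ δ * δ) f) ≤ biasedNorm p (1 + δ ^ 2) f :=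
  corollary3_general p hp0 hp1 ρ (fun _ hq => abs_le_rhoSinh_of_mem hp0 hp1 hρ hq) n f δ
    (abs_le.2 ⟨by linarith, hδ1⟩)
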